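/- All graphs are finite and simple. For a graph $G$ and positive integers $k, m$: $G^{1/m}$ is the graph obtained from $G$ by replacing each edge with a path with $m$ edges; $G^{k}$ is the graph on $V(G)$ in which two distinct vertices are adjacent iff there is a walk of length $k$ between them in $G$; and $G^{k/m}=(G^{1/m})^{k}$. Let $\mathrm{og}(G)$ be the odd girth of $G$ (the length of a shortest odd cycle). For positive integers $n\ge 2d$ the circular complete graph $K_{n/d}$ has vertex set $\{0,\dots,n-1\}$, with $i,j$ adjacent iff $d\le |i-j|\le n-d$, and $\chi_c(G)$ is the infimum of $n/d$ over all pairs $(n,d)$ such that $G$ admits a homomorphism to $K_{n/d}$. For a non-bipartite graph $G$ with chromatic number $\chi(G)$ and an integer $i\ge 3-\chi(G)$ put $$\theta_i(G)=\sup\left\{\tfrac{2r+1}{2s+1} : r,s\in\mathbb{Z}_{\ge 0},\ \chi\bigl(G^{\frac{2r+1}{2s+1}}\bigr)\le \chi(G)+i,\ \tfrac{2r+1}{2s+1}<\mathrm{og}(G)\right\},$$ and $\mu(G)=\theta_{3-\chi(G)}(G)$. **Corollary.** Let $r$ and $s$ be non-negative integers and let $G$ be a non-bipartite graph with $\frac{2r+1}{2s+1}<\mathrm{og}(G)$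 (equivalently, no closed walk of length $2r+1$ exists in $G^{\frac{1}{2s+1}}$, so that no loops have to be suppressed in $G^{\frac{2r+1}{2s+1}}$). If $\chi_c\bigl(G^{\frac{2r+1}{2s+1}}\bigr)<4$, then $$\mu\bigl(G^{\frac{2r+1}{2s+1}}\bigr)=\frac{2s+1}{2r+1}\,\mu(G)=\frac{2s+1}{3(2r+1)}\cdot\frac{\chi_c(G)}{\chi_c(G)-2}.$$ -/

import Mathlib

namespace GraphPower

universe u

variable {V : Type u}

/-- The `k`-th power `G^k`: distinct vertices `u`, `v` are adjacent iff `G` has a walk of length `k`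
between them. -/
def power (G : SimpleGraph V) (k : ℕ) : SimpleGraph V where
  Adj a b := a ≠ b ∧ ∃ p : G.Walk a b, p.length = k
  symm := ⟨fun a b ⟨hab, p, hp⟩ => ⟨hab.symm, p.reverse, by rw [p.length_reverse, hp]⟩⟩
  loopless := ⟨fun _ h => h.1 rfl⟩

/-- Vertices of the `s`-subdivision: the vertices of `G`, and `s - 1` inner vertices per edge. -/
abbrev SubdivVertex (G : SimpleGraph V) (s : ℕ) : Type u :=
  V ⊕ (G.edgeSet × Fin (s - 1))

/-- The `i`-th vertex (`0 ≤ i ≤ s`) on the path with `s` edges that replaces the edge `e`. The path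
runs from one end of `e` to the other, in a direction that is chosen once for each edge. -/
noncomputable def pathVertex (G : SimpleGraph V) (s : ℕ) (e : G.edgeSet) (i : ℕ) :
    SubdivVertex G s :=
  if i = 0 then Sum.inl (Quot.out e.1).1
  else if h : i - 1 < s - 1 then Sum.inr (e, ⟨i - 1, h⟩)
  else Sum.inl (Quot.out e.1).2

/-- The graph `G^{1/s}` (`s ≥ 1`): every edge of `G` is replaced by a path with `s` edges
(hence with `s + 1` vertices, the two ends of the edge included). -/
def subdivision (G : SimpleGraph V) (s : ℕ) : SimpleGraph (SubdivVertex G s) where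
  Adj x y := x ≠ y ∧ ∃ (e : G.edgeSet) (i : ℕ), i < s ∧
    ((x = pathVertex G s e i ∧ y = pathVertex G s e (i + 1)) ∨
      (y = pathVertex G s e i ∧ x = pathVertex G s e (i + 1)))
  symm := ⟨fun _ _ ⟨hxy, e, i, hi, h⟩ => ⟨hxy.symm, e, i, hi, h.symm⟩⟩
  loopless := ⟨fun _ h => h.1 rfl⟩

/-- The fractional power `G^{r/s} = (G^{1/s})^r`. -/
def fracPower (G : SimpleGraph V) (r s : ℕ) : SimpleGraph (SubdivVertex G s) :=
  power (subdivision G s) r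

/-- The odd girth of `G`: the length of a shortest odd cycle (`⊤` if there is none). -/
noncomputable def oddGirth (G : SimpleGraph V) : ℕ∞ :=
  ⨅ (a : V) (w : G.Walk a a) (_ : w.IsCycle) (_ : Odd w.length), (w.length : ℕ∞)

/-- The circular complete graph `K_{n/d}` on `{0, …, n - 1}`: `i` and `j` are adjacent iff
`d ≤ |i - j| ≤ n - d`. (For `d ≥ 1` the condition `i ≠ j` is automatic.) -/
def circularComplete (n d : ℕ) : SimpleGraph (Fin n) where
  Adj i j := i ≠ j ∧ (d : ℤ) ≤ |(i : ℤ) - (j : ℤ)| ∧ |(i : ℤ) - (j : ℤ)| ≤ (n : ℤ) - (d : ℤ)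
  symm := ⟨fun i j ⟨h, h1, h2⟩ => ⟨h.symm, by rwa [abs_sub_comm], by rwa [abs_sub_comm]⟩⟩
  loopless := ⟨fun _ h => h.1 rfl⟩

/-- The circular chromatic number `χ_c(G)`: the infimum of `n / d` over all `(n, d)`-colourings. -/
noncomputable def circularChromaticNumber (G : SimpleGraph V) : ℝ :=
  sInf {x : ℝ | ∃ n d : ℕ, 0 < d ∧ 2 * d ≤ n ∧ Nonempty (G →g circularComplete n d) ∧
    x = (n : ℝ) / (d : ℝ)}

/-- The chromatic number as a natural number (for graphs that have a finite colouring, in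
particular for all finite graphs). -/
noncomputable def chi (G : SimpleGraph V) : ℕ := G.chromaticNumber.toNat

/-- The `i`-th power thickness `θ_i(G)`, the supremum of the fractions `(2r+1)/(2s+1)` below the
odd girth of `G` for which `χ(G^{(2r+1)/(2s+1)}) ≤ χ(G) + i`. -/
noncomputable def powerThickness (G : SimpleGraph V) (i : ℤ) : ℝ :=
  sSup {x : ℝ | ∃ r s : ℕ,
    (chi (fracPower G (2 * r + 1) (2 * s + 1)) : ℤ) ≤ (chi G : ℤ) + i ∧
    ((2 * r + 1 : ℕ) : ℕ∞) < ((2 * s + 1 : ℕ) : ℕ∞) * oddGirth G ∧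
    x = (2 * r + 1 : ℝ) / (2 * s + 1 : ℝ)}

/-- `μ(G) = θ_{3 - χ(G)}(G)`. -/
noncomputable def mu (G : SimpleGraph V) : ℝ := powerThickness G (3 - (chi G : ℤ))

end GraphPower


/-
Label the vertices of `G` by points of the circle `ℝ / ℤ` and let `δ(G)` be the least `ε` for which
some labelling puts adjacent vertices within `ε` of being antipodal. An `(n, d)`-colouring is a
labelling with error at most `1/2 - d/n`, and rounding labels down gives a converse, so that
`χ_c(G) = 1 / (1/2 - δ(G))`, and `G` is 3-colourable iff `δ(G) ≤ 1/6`.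

For odd `m` and `k` one has `δ(G^{1/m}) = δ(G) / m`, since the error of an edge can be spread evenly
over its path, and `δ(G^k) ≤ k δ(G)`, since errors add up along a walk. If `δ(G^k) < 1/4` and `G`
has no closed walk of length `k`, the second inequality is an equality: the signed errors along the
edges, lifted to `ℝ`, add up to at most `δ(G^k)` along every walk of length `k`, hence a potential
redistributes them so that no edge has an error larger than `δ(G^k) / k`.

Consequently `δ(G^{k/m}) = (k/m) δ(G)` below the odd girth whenever the left side is less than
`1/4`. Thus `G^{k/m}` is 3-colourable iff `(k/m) δ(G) ≤ 1/6`, which means that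
`μ(G) = 1 / (6 δ(G))`.
-/

namespace GraphPower

open SimpleGraph

section Circle

/-- The antipode of `0` on the circle `ℝ / ℤ`. -/
noncomputable def halfTurn : UnitAddCircle := ((1 / 2 : ℝ) : UnitAddCircle)

lemma norm_halfTurn : ‖halfTurn‖ = 1 / 2 := by
  simpa [halfTurn] using AddCircle.norm_half_period_eq (1 : ℝ)

lemma two_nsmul_halfTurn : 2 • halfTurn = 0 := by
  rw [halfTurn, ← AddCircle.coe_nsmul, nsmul_eq_mul, Nat.cast_ofNat, mul_one_div_cancel two_ne_zero]
  exact AddCircle.coe_period 1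

lemma neg_halfTurn : -halfTurn = halfTurn :=
  neg_eq_of_add_eq_zero_left (by rw [← two_nsmul, two_nsmul_halfTurn])

lemma nsmul_halfTurn_of_odd {n : ℕ} (hn : Odd n) : n • halfTurn = halfTurn := by
  obtain ⟨j, rfl⟩ := hn
  rw [succ_nsmul, mul_nsmul, two_nsmul_halfTurn, nsmul_zero, zero_add]

lemma exists_coe_eq_and_abs_eq_norm (x : UnitAddCircle) :
    ∃ t : ℝ, (t : UnitAddCircle) = x ∧ |t| = ‖x‖ := by
  obtain ⟨t, -, rfl⟩ := AddCircle.eq_coe_Ico x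
  refine ⟨t - round t, ?_, UnitAddCircle.norm_eq.symm⟩
  rw [AddCircle.coe_sub, sub_eq_self, AddCircle.coe_eq_zero_iff]
  exact ⟨round t, zsmul_one _⟩

lemma norm_coe_le_abs (t : ℝ) : ‖(t : UnitAddCircle)‖ ≤ |t| := by
  simpa [UnitAddCircle.norm_eq] using round_le t 0

lemma eq_of_coe_eq_coe_of_abs_sub_lt_one {s t : ℝ} (h : (s : UnitAddCircle) = t)
    (hst : |s - t| < 1) : s = t := by
  obtain ⟨n, hn⟩ := (AddCircle.coe_eq_zero_iff 1).1 (by rw [AddCircle.coe_sub, h, sub_self] :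
    ((s - t : ℝ) : UnitAddCircle) = 0)
  rw [zsmul_one] at hn
  rw [← hn] at hst
  have hn0 : n = 0 := Int.abs_lt_one_iff.1 (by exact_mod_cast hst)
  rw [hn0, Int.cast_zero] at hn
  linarith

lemma norm_coe_sub_halfTurn {t : ℝ} (ht : |t| ≤ 1) :
    ‖(t : UnitAddCircle) - halfTurn‖ = |(|t| - 1 / 2)| := by
  have norm_coe_of_abs_le_half : ∀ s : ℝ, |s| ≤ 1 / 2 → ‖(s : UnitAddCircle)‖ = |s| := fun s hs =>
    (AddCircle.norm_coe_eq_abs_iff 1 one_ne_zero).2 (by simpa using hs)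
  rcases le_total 0 t with h0 | h0
  · rw [abs_of_nonneg h0] at ht ⊢
    rw [halfTurn, ← AddCircle.coe_sub]
    exact norm_coe_of_abs_le_half _ (abs_le.2 ⟨by linarith, by linarith⟩)
  · rw [abs_of_nonpos h0] at ht ⊢
    rw [sub_eq_add_neg, neg_halfTurn, halfTurn, ← AddCircle.coe_add, ← abs_neg (-t - 1 / 2),
      neg_sub, sub_neg_eq_add, add_comm]
    exact norm_coe_of_abs_le_half _ (abs_le.2 ⟨by linarith, by linarith⟩)

end Circle

section Labelling

variable {V : Type*} {G : SimpleGraph V} {f : V → UnitAddCircle} {ε : ℝ} {u v : V}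

/-- A labelling of the vertices by points of the circle `ℝ / ℤ` that puts adjacent vertices at
antipodal points, up to an error of at most `ε`. -/
def IsAntipodalLabelling (G : SimpleGraph V) (ε : ℝ) (f : V → UnitAddCircle) : Prop :=
  ∀ ⦃u v⦄, G.Adj u v → ‖f v - f u - halfTurn‖ ≤ ε

/-- The least error `ε` of an antipodal labelling of `G`. The condition `0 ≤ ε` gives edgeless
graphs the defect `0`. -/
noncomputable def antipodalDefect (G : SimpleGraph V) : ℝ :=
  sInf {ε | 0 ≤ ε ∧ ∃ f, IsAntipodalLabelling G ε f}

lemma IsAntipodalLabelling.mono {δ : ℝ} (hf : IsAntipodalLabelling G ε f) (h : ε ≤ δ) :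
    IsAntipodalLabelling G δ f :=
  fun _ _ huv => (hf huv).trans h

lemma isAntipodalLabelling_half (f : V → UnitAddCircle) : IsAntipodalLabelling G (1 / 2) f :=
  fun _ _ _ => by simpa using AddCircle.norm_le_half_period 1 one_ne_zero

lemma IsAntipodalLabelling.norm_walk_le (hf : IsAntipodalLabelling G ε f) (p : G.Walk u v) :
    ‖f v - f u - p.length • halfTurn‖ ≤ p.length * ε := by
  induction p with
  | nil => simp
  | @cons u w v h p ih =>
    calc ‖f v - f u - (p.length + 1) • halfTurn‖
        = ‖(f v - f w - p.length • halfTurn) + (f w - f u - halfTurn)‖ := by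
          rw [succ_nsmul]
          congr 1
          abel
      _ ≤ p.length * ε + ε := (norm_add_le _ _).trans (add_le_add ih (hf h))
      _ = (p.length + 1 : ℕ) * ε := by push_cast; ring

lemma IsAntipodalLabelling.norm_odd_walk_le (hf : IsAntipodalLabelling G ε f) (p : G.Walk u v)
    (hp : Odd p.length) : ‖f v - f u - halfTurn‖ ≤ p.length * ε := by
  simpa only [nsmul_halfTurn_of_odd hp] using hf.norm_walk_le p

lemma isClosed_setOf_isAntipodalLabelling (G : SimpleGraph V) (ε : ℝ) :
    IsClosed {f | IsAntipodalLabelling G ε f} := by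
  simp only [IsAntipodalLabelling, Set.ofPred_forall]
  exact isClosed_iInter fun u => isClosed_iInter fun v => isClosed_iInter fun _ =>
    isClosed_le (by fun_prop) continuous_const

lemma antipodalErrors_nonempty :
    {ε | 0 ≤ ε ∧ ∃ f, IsAntipodalLabelling G ε f}.Nonempty :=
  ⟨1 / 2, by norm_num, 0, isAntipodalLabelling_half 0⟩

lemma antipodalDefect_nonneg : 0 ≤ antipodalDefect G :=
  Real.sInf_nonneg fun _ h => h.1

lemma IsAntipodalLabelling.antipodalDefect_le (hf : IsAntipodalLabelling G ε f) (hε : 0 ≤ ε) :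
    antipodalDefect G ≤ ε :=
  csInf_le ⟨0, fun _ h => h.1⟩ ⟨hε, f, hf⟩

/-- The labellings with error at most `ε` form a closed subset of the compact space `V → ℝ / ℤ`. -/
lemma exists_isAntipodalLabelling_antipodalDefect (G : SimpleGraph V) :
    ∃ f, IsAntipodalLabelling G (antipodalDefect G) f := by
  let δ (n : ℕ) : ℝ := antipodalDefect G + 1 / (n + 1)
  have labellings_nonempty (n : ℕ) : {f | IsAntipodalLabelling G (δ n) f}.Nonempty := by
    obtain ⟨ε, ⟨-, f, hf⟩, hε⟩ := exists_lt_of_csInf_lt antipodalErrors_nonempty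
      (lt_add_of_pos_right (antipodalDefect G) (Nat.one_div_pos_of_nat (n := n)))
    exact ⟨f, hf.mono hε.le⟩
  obtain ⟨f, hf⟩ := IsCompact.nonempty_iInter_of_sequence_nonempty_isCompact_isClosed
    (fun n => {f | IsAntipodalLabelling G (δ n) f})
    (fun n f hf => IsAntipodalLabelling.mono hf
      (add_le_add_right (Nat.one_div_le_one_div n.le_succ) _))
    labellings_nonempty (isClosed_setOf_isAntipodalLabelling G _).isCompact
    (fun n => isClosed_setOf_isAntipodalLabelling G _)
  rw [Set.mem_iInter] at hf
  have δ_tendsto : Filter.Tendsto δ Filter.atTop (nhds (antipodalDefect G)) := by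
    simpa only [add_zero] using
      tendsto_one_div_add_atTop_nhds_zero_nat.const_add (antipodalDefect G)
  exact ⟨f, fun u v huv => ge_of_tendsto' δ_tendsto fun n => hf n huv⟩

lemma half_le_length_mul_antipodalDefect (p : G.Walk u u) (hp : Odd p.length) :
    1 / 2 ≤ p.length * antipodalDefect G := by
  obtain ⟨f, hf⟩ := exists_isAntipodalLabelling_antipodalDefect G
  simpa [norm_halfTurn] using hf.norm_odd_walk_le p hp

lemma antipodalDefect_pos (hG : ¬ G.IsBipartite) : 0 < antipodalDefect G := by
  obtain ⟨u, p, hp⟩ : ∃ (u : V) (p : G.Walk u u), Odd p.length := by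
    by_contra! h
    exact hG (two_colorable_iff_forall_loop_even.2 fun u p => Nat.not_odd_iff_even.1 (h u p))
  refine pos_of_mul_pos_right ?_ (Nat.cast_nonneg p.length)
  linarith [half_le_length_mul_antipodalDefect p hp]

lemma antipodalDefect_power_le (G : SimpleGraph V) {k : ℕ} (hk : Odd k) :
    antipodalDefect (power G k) ≤ k * antipodalDefect G := by
  obtain ⟨f, hf⟩ := exists_isAntipodalLabelling_antipodalDefect G
  refine IsAntipodalLabelling.antipodalDefect_le (f := f) ?_
    (mul_nonneg (Nat.cast_nonneg k) antipodalDefect_nonneg)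
  rintro u v ⟨-, p, rfl⟩
  exact hf.norm_odd_walk_le p hk

end Labelling

section Potential

variable {V : Type*} {G : SimpleGraph V} {a : G.Dart → ℝ} {u v w : V}

/-- The sum of an edge weight along a walk. -/
def walkSum (a : G.Dart → ℝ) (p : G.Walk u v) : ℝ :=
  (p.darts.map a).sum

@[simp]
lemma walkSum_nil : walkSum a (.nil : G.Walk u u) = 0 := rfl

@[simp]
lemma walkSum_cons (h : G.Adj u v) (p : G.Walk v w) :
    walkSum a (.cons h p) = a ⟨(u, v), h⟩ + walkSum a p := by
  simp [walkSum]

lemma walkSum_append (p : G.Walk u v) (q : G.Walk v w) :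
    walkSum a (p.append q) = walkSum a p + walkSum a q := by
  simp [walkSum]

lemma walkSum_sub_const (c : ℝ) (p : G.Walk u v) :
    walkSum (fun d => a d - c) p = walkSum a p - p.length * c := by
  induction p with
  | nil => simp
  | cons h p ih =>
    rw [walkSum_cons, walkSum_cons, ih, Walk.length_cons]
    push_cast
    ring

lemma walkSum_le_length_mul {b : ℝ} (ha : ∀ d, a d ≤ b) (p : G.Walk u v) :
    walkSum a p ≤ p.length * b := by
  simpa [walkSum] using List.sum_le_card_nsmul (p.darts.map a) b (by simpa using fun d _ => ha d)

/-- As in the Bellman-Ford algorithm, `h v` is the largest weight of a walk that ends at `v`. -/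
lemma exists_potential
    (ha : ∀ v, BddAbove (Set.range fun p : (u : V) × G.Walk u v => walkSum a p.2)) :
    ∃ h : V → ℝ, ∀ d : G.Dart, a d ≤ h d.snd - h d.fst := by
  refine ⟨fun v => ⨆ p : (u : V) × G.Walk u v, walkSum a p.2, fun d => ?_⟩
  have : Nonempty ((u : V) × G.Walk u d.fst) := ⟨d.fst, .nil⟩
  rw [le_sub_comm]
  refine ciSup_le fun ⟨u, p⟩ => le_sub_iff_add_le.2 ?_
  have hp := le_ciSup (ha d.snd) ⟨u, p.append (.cons d.adj .nil)⟩
  rwa [walkSum_append, walkSum_cons, walkSum_nil, add_zero] at hp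

lemma walkSum_le_mul_of_forall_length_eq {b : ℝ} {k : ℕ} (hk : 0 < k) (hb : 0 ≤ b)
    (ha : ∀ d, a d ≤ b) (hs : ∀ ⦃u v⦄ (p : G.Walk u v), p.length = k → walkSum a p ≤ 0)
    (p : G.Walk u v) : walkSum a p ≤ k * b := by
  induction hn : p.length using Nat.strong_induction_on generalizing u with
  | _ n ih =>
    rcases le_total p.length k with hpk | hpk
    · calc walkSum a p ≤ p.length * b := walkSum_le_length_mul ha p
        _ ≤ k * b := by gcongr
    · have hdrop : (p.drop k).length = p.length - k := p.drop_length k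
      rw [← p.append_take_drop_eq k, walkSum_append]
      linarith [hs (p.take k) (by rw [p.take_length, min_eq_left hpk]),
        ih _ (by omega) (p.drop k) rfl]

lemma exists_potential_of_forall_length_eq {b c : ℝ} {k : ℕ} (hk : 0 < k) (ha : ∀ d, a d ≤ b)
    (hs : ∀ ⦃u v⦄ (p : G.Walk u v), p.length = k → walkSum a p ≤ k * c) :
    ∃ h : V → ℝ, ∀ d : G.Dart, a d - c ≤ h d.snd - h d.fst := by
  refine exists_potential fun v => ⟨k * max (b - c) 0, ?_⟩
  rintro _ ⟨⟨u, p⟩, rfl⟩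
  refine walkSum_le_mul_of_forall_length_eq hk (le_max_right _ _)
    (fun d => le_max_of_le_left (sub_le_sub_right (ha d) c)) (fun u v q hq => ?_) p
  rw [walkSum_sub_const, hq]
  exact sub_nonpos.2 (hs q hq)

end Potential

section Power

variable {V : Type*} {G : SimpleGraph V} {f : V → UnitAddCircle} {a : G.Dart → ℝ} {ε : ℝ} {k : ℕ}
  {u v : V}

lemma exists_walk_length_add_two_mul (p : G.Walk u v) (hp : 0 < p.length) (i : ℕ) :
    ∃ q : G.Walk u v, q.length = p.length + 2 * i := by
  cases p with
  | nil => simp at hp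
  | cons h p =>
    induction i with
    | zero => exact ⟨.cons h p, rfl⟩
    | succ i ih =>
      obtain ⟨q, hq⟩ := ih
      exact ⟨.cons h (.cons h.symm q), by simp only [Walk.length_cons] at hq ⊢; omega⟩

lemma IsAntipodalLabelling.norm_le_of_power (hf : IsAntipodalLabelling (power G k) ε f)
    (hk : Odd k) (hclosed : ∀ (w : V) (q : G.Walk w w), q.length ≠ k) (p : G.Walk u v)
    (hp : Odd p.length) (hpk : p.length ≤ k) : ‖f v - f u - halfTurn‖ ≤ ε := by
  obtain ⟨i, hi⟩ := hp
  obtain ⟨j, hj⟩ := hk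
  obtain ⟨q, hq⟩ := exists_walk_length_add_two_mul p (by omega) (j - i)
  have hqk : q.length = k := by omega
  have huv : u ≠ v := by
    rintro rfl
    exact hclosed u q hqk
  exact hf ⟨huv, q, hqk⟩

lemma coe_walkSum (ha : ∀ d, (a d : UnitAddCircle) = f d.snd - f d.fst - halfTurn)
    (p : G.Walk u v) :
    (walkSum a p : UnitAddCircle) = f v - f u - p.length • halfTurn := by
  induction p with
  | nil => simp
  | cons h p ih =>
    rw [walkSum_cons, AddCircle.coe_add, ha, ih, Walk.length_cons, succ_nsmul]
    abel

/-- Two further edges change a sum of absolute value at most `ε` to one of absolute value at most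
`3 * ε`. Its class modulo `1` has norm at most `ε`, and `4 * ε < 1` leaves no room for an integer
between the two bounds. -/
lemma abs_walkSum_le_of_odd (ha : ∀ d, (a d : UnitAddCircle) = f d.snd - f d.fst - halfTurn)
    (haε : ∀ d, |a d| ≤ ε) (hε : ε < 1 / 4)
    (hf : ∀ ⦃u v⦄ (p : G.Walk u v), Odd p.length → p.length ≤ k → ‖f v - f u - halfTurn‖ ≤ ε)
    (p : G.Walk u v) (hp : Odd p.length) (hpk : p.length ≤ k) : |walkSum a p| ≤ ε := by
  obtain ⟨j, hj⟩ := hp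
  induction j generalizing u with
  | zero =>
    match p, hj with
    | .cons h .nil, _ => simpa only [walkSum_cons, walkSum_nil, add_zero] using haε ⟨(_, _), h⟩
  | succ j ih =>
    match p, hj with
    | .cons h (.cons h' q), hj =>
      have hq : |walkSum a q| ≤ ε := by
        simp only [Walk.length_cons] at hj hpk
        exact ih q (by omega) (by omega)
      obtain ⟨t, ht, htε⟩ := exists_coe_eq_and_abs_eq_norm
        (walkSum a (.cons h (.cons h' q)) : UnitAddCircle)
      have hp : Odd (Walk.cons h (Walk.cons h' q)).length := ⟨j + 1, hj⟩
      rw [coe_walkSum ha, nsmul_halfTurn_of_odd hp] at htε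
      have htε' : |t| ≤ ε := htε.trans_le (hf _ hp hpk)
      suffices t = walkSum a (.cons h (.cons h' q)) by rwa [← this]
      refine eq_of_coe_eq_coe_of_abs_sub_lt_one ht ?_
      have h₁ := abs_le.1 (haε ⟨(_, _), h⟩)
      have h₂ := abs_le.1 (haε ⟨(_, _), h'⟩)
      rw [abs_le] at hq htε'
      rw [walkSum_cons, walkSum_cons, abs_lt]
      constructor <;> linarith

lemma IsAntipodalLabelling.exists_antisymm_lift (hf : IsAntipodalLabelling G ε f)
    (hε : ε < 1 / 2) :
    ∃ a : G.Dart → ℝ, (∀ d, (a d : UnitAddCircle) = f d.snd - f d.fst - halfTurn) ∧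
      (∀ d, |a d| ≤ ε) ∧ ∀ d, a d.symm = -a d := by
  choose a ha ha_abs using fun d : G.Dart =>
    exists_coe_eq_and_abs_eq_norm (f d.snd - f d.fst - halfTurn)
  have haε (d : G.Dart) : |a d| ≤ ε := (ha_abs d).trans_le (hf d.adj)
  refine ⟨a, ha, haε, fun d => eq_of_coe_eq_coe_of_abs_sub_lt_one ?_ ?_⟩
  · rw [AddCircle.coe_neg, ha, ha, neg_sub, sub_eq_add_neg, neg_halfTurn]
    simp only [Dart.symm_toProd, Prod.fst_swap, Prod.snd_swap]
    abel
  · have h₁ := abs_le.1 (haε d)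
    have h₂ := abs_le.1 (haε d.symm)
    rw [abs_lt]
    constructor <;> linarith

lemma isAntipodalLabelling_sub_potential {h : V → ℝ} {c : ℝ}
    (ha : ∀ d, (a d : UnitAddCircle) = f d.snd - f d.fst - halfTurn)
    (ha_symm : ∀ d, a d.symm = -a d) (hh : ∀ d, a d - c ≤ h d.snd - h d.fst) :
    IsAntipodalLabelling G c fun v => f v - (h v : UnitAddCircle) := by
  intro u v huv
  let d : G.Dart := ⟨(u, v), huv⟩
  have h₁ : a d - c ≤ h v - h u := hh d
  have h₂ : -a d - c ≤ h u - h v := ha_symm d ▸ hh d.symm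
  calc ‖f v - h v - (f u - h u) - halfTurn‖ = ‖((a d - (h v - h u) : ℝ) : UnitAddCircle)‖ := by
        rw [AddCircle.coe_sub, ha, AddCircle.coe_sub]
        congr 1
        abel
    _ ≤ |a d - (h v - h u)| := norm_coe_le_abs _
    _ ≤ c := abs_le.2 ⟨by linarith, by linarith⟩

lemma mul_antipodalDefect_le_antipodalDefect_power (hk : Odd k)
    (hδ : antipodalDefect (power G k) < 1 / 4)
    (hclosed : ∀ (w : V) (q : G.Walk w w), q.length ≠ k) :
    k * antipodalDefect G ≤ antipodalDefect (power G k) := by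
  obtain ⟨f, hf⟩ := exists_isAntipodalLabelling_antipodalDefect (power G k)
  set ε := antipodalDefect (power G k)
  have hk0 : (0 : ℝ) < k := Nat.cast_pos.2 hk.pos
  have hodd := fun ⦃u v : V⦄ (p : G.Walk u v) => hf.norm_le_of_power hk hclosed p
  have hfG : IsAntipodalLabelling G ε f := fun u v huv =>
    hodd (.cons huv .nil) odd_one hk.pos
  obtain ⟨a, ha, haε, ha_symm⟩ := hfG.exists_antisymm_lift (by linarith)
  obtain ⟨h, hh⟩ : ∃ h : V → ℝ, ∀ d, a d - ε / k ≤ h d.snd - h d.fst := by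
    refine exists_potential_of_forall_length_eq hk.pos (fun d => (le_abs_self _).trans (haε d))
      fun u v p hp => ?_
    rw [mul_div_cancel₀ _ hk0.ne']
    exact (le_abs_self _).trans (abs_walkSum_le_of_odd ha haε hδ hodd p (hp ▸ hk) hp.le)
  rw [← le_div_iff₀' hk0]
  exact (isAntipodalLabelling_sub_potential ha ha_symm hh).antipodalDefect_le
    (div_nonneg antipodalDefect_nonneg hk0.le)

end Power

section OddCycle

variable {V : Type*} {G : SimpleGraph V} {u v : V}

lemma exists_odd_isCycle_or_length_bypass_mod_two [DecidableEq V] (p : G.Walk u v) :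
    (∃ (x : V) (c : G.Walk x x), c.IsCycle ∧ Odd c.length ∧ c.length ≤ p.length) ∨
      p.bypass.length % 2 = p.length % 2 := by
  induction p with
  | nil => exact Or.inr rfl
  | @cons u v w h p ih =>
    obtain ⟨x, c, hc, hodd, hle⟩ | ih := ih
    · exact Or.inl ⟨x, c, hc, hodd, hle.trans (Nat.le_succ _)⟩
    by_cases hs : u ∈ p.bypass.support
    · have hlen := congrArg Walk.length (p.bypass.take_spec hs)
      rw [Walk.length_append] at hlen
      have hpath : (p.bypass.takeUntil u hs).IsPath := p.bypass_isPath.takeUntil hs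
      have hle := p.length_bypass_le_length
      rcases Nat.even_or_odd (p.bypass.takeUntil u hs).length with heven | hodd
      · refine Or.inl ⟨u, .cons h (p.bypass.takeUntil u hs), ?_, heven.add_one, ?_⟩
        · rw [Walk.cons_isCycle_iff]
          refine ⟨hpath, fun hmem => ?_⟩
          rw [Sym2.eq_swap] at hmem
          rw [hpath.length_eq_one_of_mem_edges hmem] at heven
          exact Nat.not_even_one heven
        · simp only [Walk.length_cons]
          omega
      · right
        simp only [Walk.bypass, hs, dite_true, Walk.length_cons]
        obtain ⟨i, hi⟩ := hodd
        omega
    · right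
      simp only [Walk.bypass, hs, dite_false, Walk.length_cons]
      omega

lemma exists_odd_isCycle_length_le (p : G.Walk u u) (hp : Odd p.length) :
    ∃ (x : V) (c : G.Walk x x), c.IsCycle ∧ Odd c.length ∧ c.length ≤ p.length := by
  classical
  refine (exists_odd_isCycle_or_length_bypass_mod_two p).resolve_right fun h => ?_
  rw [Walk.length_eq_zero_iff.2 (Walk.isPath_iff_nil.1 p.bypass_isPath), Nat.odd_iff.1 hp] at h
  exact zero_ne_one h

lemma oddGirth_le_length (p : G.Walk u u) (hp : Odd p.length) : oddGirth G ≤ p.length := by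
  obtain ⟨x, c, hc, hodd, hle⟩ := exists_odd_isCycle_length_le p hp
  calc oddGirth G ≤ c.length := iInf₂_le_of_le x c (iInf₂_le hc hodd)
    _ ≤ p.length := Nat.cast_le.2 hle

end OddCycle

section Subdivision

variable {V : Type*} {G : SimpleGraph V} {m : ℕ}

lemma adj_out (e : G.edgeSet) : G.Adj (Quot.out e.1).1 (Quot.out e.1).2 := by
  have he : s((Quot.out e.1).1, (Quot.out e.1).2) = e.1 := Quot.out_eq e.1
  rw [← mem_edgeSet, he]
  exact e.2

lemma out_mk_eq_or (u v : V) : Quot.out s(u, v) = (u, v) ∨ Quot.out s(u, v) = (v, u) := by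
  have huv : s((Quot.out s(u, v)).1, (Quot.out s(u, v)).2) = s(u, v) := Quot.out_eq s(u, v)
  exact (Sym2.eq_iff.1 huv).imp (fun h => Prod.ext h.1 h.2) (fun h => Prod.ext h.1 h.2)

lemma pathVertex_zero (e : G.edgeSet) : pathVertex G m e 0 = .inl (Quot.out e.1).1 :=
  if_pos rfl

lemma pathVertex_last (hm : 0 < m) (e : G.edgeSet) :
    pathVertex G m e m = .inl (Quot.out e.1).2 := by
  rw [pathVertex, if_neg hm.ne', dif_neg (lt_irrefl _)]

lemma pathVertex_succ {i : ℕ} (hi : i < m - 1) (e : G.edgeSet) :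
    pathVertex G m e (i + 1) = .inr (e, ⟨i, hi⟩) := by
  rw [pathVertex, if_neg i.succ_ne_zero, dif_pos (by exact hi)]
  rfl

section Interpolation

variable {f : V → UnitAddCircle} {t : G.edgeSet → UnitAddCircle} {ε : ℝ}

/-- The extension of a labelling of `G` to its subdivision that advances by `t e` in each step along
the path replacing the edge `e`. -/
noncomputable def interpolate (m : ℕ) (f : V → UnitAddCircle) (t : G.edgeSet → UnitAddCircle) :
    SubdivVertex G m → UnitAddCircle :=
  Sum.elim f fun x => f (Quot.out x.1.1).1 + ((x.2 : ℕ) + 1) • t x.1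

lemma interpolate_pathVertex
    (ht : ∀ e, f (Quot.out e.1).2 = f (Quot.out e.1).1 + m • t e) (e : G.edgeSet) {i : ℕ}
    (hi : i ≤ m) : interpolate m f t (pathVertex G m e i) = f (Quot.out e.1).1 + i • t e := by
  rcases i with - | i
  · rw [pathVertex_zero, zero_nsmul, add_zero]
    rfl
  · rcases hi.lt_or_eq with him | rfl
    · rw [pathVertex_succ (by omega)]
      rfl
    · rw [pathVertex_last i.succ_pos, ← ht]
      rfl

lemma isAntipodalLabelling_interpolate
    (ht : ∀ e, f (Quot.out e.1).2 = f (Quot.out e.1).1 + m • t e)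
    (htε : ∀ e, ‖t e - halfTurn‖ ≤ ε) :
    IsAntipodalLabelling (subdivision G m) ε (interpolate m f t) := by
  rintro x y ⟨-, e, i, hi, ⟨rfl, rfl⟩ | ⟨rfl, rfl⟩⟩ <;>
    rw [interpolate_pathVertex ht e hi, interpolate_pathVertex ht e hi.le, succ_nsmul]
  · convert htε e using 2
    abel
  · calc _ = ‖-(t e - halfTurn)‖ := by
          rw [neg_sub, sub_eq_add_neg, neg_halfTurn]
          congr 1
          abel
      _ ≤ ε := by
          rw [norm_neg]
          exact htε e

lemma antipodalDefect_subdivision_le (hm : Odd m) :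
    antipodalDefect (subdivision G m) ≤ antipodalDefect G / m := by
  obtain ⟨f, hf⟩ := exists_isAntipodalLabelling_antipodalDefect G
  have hm0 : (0 : ℝ) < m := Nat.cast_pos.2 hm.pos
  choose a ha ha_abs using fun e : G.edgeSet =>
    exists_coe_eq_and_abs_eq_norm (f (Quot.out e.1).2 - f (Quot.out e.1).1 - halfTurn)
  refine (isAntipodalLabelling_interpolate (f := f)
    (t := fun e => halfTurn + ((a e / m : ℝ) : UnitAddCircle)) (fun e => ?_)
    fun e => ?_).antipodalDefect_le (div_nonneg antipodalDefect_nonneg hm0.le)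
  · rw [nsmul_add, nsmul_halfTurn_of_odd hm, ← AddCircle.coe_nsmul, nsmul_eq_mul,
      mul_div_cancel₀ _ hm0.ne', ha]
    abel
  · calc ‖halfTurn + ((a e / m : ℝ) : UnitAddCircle) - halfTurn‖ ≤ |a e / m| := by
          rw [add_sub_cancel_left]
          exact norm_coe_le_abs _
      _ = |a e| / m := by rw [abs_div, Nat.abs_cast]
      _ ≤ antipodalDefect G / m := by
          rw [ha_abs]
          gcongr
          exact hf (adj_out e)

end Interpolation

lemma subdivision_adj_pathVertex_succ {i : ℕ} (hi : i < m) (e : G.edgeSet) :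
    (subdivision G m).Adj (pathVertex G m e i) (pathVertex G m e (i + 1)) := by
  refine ⟨fun h => ?_, e, i, hi, Or.inl ⟨rfl, rfl⟩⟩
  rcases i with - | i
  · rcases (Nat.succ_le_of_lt hi).lt_or_eq with hm | rfl
    · rw [pathVertex_zero, pathVertex_succ (by omega)] at h
      exact Sum.inl_ne_inr h
    · rw [pathVertex_zero, pathVertex_last hi] at h
      exact (adj_out e).ne (Sum.inl_injective h)
  · rcases (Nat.succ_le_of_lt hi).lt_or_eq with hm | rfl
    · rw [pathVertex_succ (by omega), pathVertex_succ (by omega)] at h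
      simp at h
    · rw [pathVertex_succ (by omega), pathVertex_last (by omega)] at h
      exact Sum.inr_ne_inl h

lemma exists_walk_pathVertex (e : G.edgeSet) {i : ℕ} (hi : i ≤ m) :
    ∃ p : (subdivision G m).Walk (pathVertex G m e 0) (pathVertex G m e i), p.length = i := by
  induction i with
  | zero => exact ⟨.nil, rfl⟩
  | succ i ih =>
    obtain ⟨p, hp⟩ := ih (by omega)
    exact ⟨p.concat (subdivision_adj_pathVertex_succ hi e), by rw [Walk.length_concat, hp]⟩

lemma exists_walk_inl_inl_of_adj (hm : 0 < m) {u v : V} (h : G.Adj u v) :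
    ∃ p : (subdivision G m).Walk (.inl u) (.inl v), p.length = m := by
  let e : G.edgeSet := ⟨s(u, v), h⟩
  obtain ⟨p, hp⟩ := exists_walk_pathVertex e (le_refl m)
  have h₀ : pathVertex G m e 0 = .inl (Quot.out s(u, v)).1 := pathVertex_zero e
  have h₁ : pathVertex G m e m = .inl (Quot.out s(u, v)).2 := pathVertex_last hm e
  rcases out_mk_eq_or u v with huv | huv <;> rw [huv] at h₀ h₁
  · exact ⟨p.copy h₀ h₁, by rwa [Walk.length_copy]⟩
  · exact ⟨(p.copy h₀ h₁).reverse, by rwa [Walk.length_reverse, Walk.length_copy]⟩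

lemma antipodalDefect_le_mul_subdivision (hm : Odd m) :
    antipodalDefect G ≤ m * antipodalDefect (subdivision G m) := by
  obtain ⟨f, hf⟩ := exists_isAntipodalLabelling_antipodalDefect (subdivision G m)
  refine IsAntipodalLabelling.antipodalDefect_le (f := fun v => f (.inl v)) (fun u v huv => ?_)
    (mul_nonneg m.cast_nonneg antipodalDefect_nonneg)
  obtain ⟨p, hp⟩ := exists_walk_inl_inl_of_adj hm.pos huv
  simpa only [hp] using hf.norm_odd_walk_le p (by rwa [hp])

lemma antipodalDefect_subdivision (hm : Odd m) :
    antipodalDefect (subdivision G m) = antipodalDefect G / m := by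
  refine (antipodalDefect_subdivision_le hm).antisymm ?_
  rw [div_le_iff₀' (Nat.cast_pos.2 hm.pos)]
  exact antipodalDefect_le_mul_subdivision hm

section Shadow

variable {v a b : V} {n : ℕ}

/-- What a walk of length `n` from `b` to `v` in `G^{1/m}` leaves in `G`: a walk from `b` to `v`
whose length, multiplied by `m`, is at most `n` and has the parity of `n`. -/
def HasShadow (G : SimpleGraph V) (m : ℕ) (v b : V) (n : ℕ) : Prop :=
  ∃ (q : G.Walk b v) (j : ℕ), n = m * q.length + 2 * j

/-- The extension of `HasShadow` to all starting points in `G^{1/m}`: from an inner vertex of a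
subdivided edge, one first walks straight to one of the two ends. -/
def HasSubdivShadow (G : SimpleGraph V) (m : ℕ) (v : V) : SubdivVertex G m → ℕ → Prop
  | .inl b, n => HasShadow G m v b n
  | .inr (e, i), n => (∃ l, n = l + (i + 1) ∧ HasShadow G m v (Quot.out e.1).1 l) ∨
      ∃ l, n = l + (m - (i + 1)) ∧ HasShadow G m v (Quot.out e.1).2 l

lemma HasShadow.add_two (h : HasShadow G m v b n) : HasShadow G m v b (n + 2) := by
  obtain ⟨q, j, rfl⟩ := h
  exact ⟨q, j + 1, by ring⟩

lemma HasShadow.of_adj (h : HasShadow G m v b n) (hab : G.Adj a b) :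
    HasShadow G m v a (n + m) := by
  obtain ⟨q, j, rfl⟩ := h
  exact ⟨.cons hab q, j, by rw [Walk.length_cons]; ring⟩

lemma hasSubdivShadow_pathVertex {i : ℕ} (hm : 0 < m) (hi : i ≤ m) (e : G.edgeSet) :
    HasSubdivShadow G m v (pathVertex G m e i) n ↔
      (∃ l, n = l + i ∧ HasShadow G m v (Quot.out e.1).1 l) ∨
        ∃ l, n = l + (m - i) ∧ HasShadow G m v (Quot.out e.1).2 l := by
  rcases i with - | i
  · rw [pathVertex_zero]
    refine ⟨fun h => Or.inl ⟨n, rfl, h⟩, ?_⟩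
    rintro (⟨l, rfl, h⟩ | ⟨l, rfl, h⟩)
    exacts [h, h.of_adj (adj_out e)]
  · rcases hi.lt_or_eq with him | rfl
    · rw [pathVertex_succ (by omega)]
      rfl
    · rw [pathVertex_last hm, Nat.sub_self]
      refine ⟨fun h => Or.inr ⟨n, rfl, h⟩, ?_⟩
      rintro (⟨l, rfl, h⟩ | ⟨l, rfl, h⟩)
      exacts [h.of_adj (adj_out e).symm, h]

lemma HasSubdivShadow.of_adj {x y : SubdivVertex G m} (h : HasSubdivShadow G m v y n)
    (hxy : (subdivision G m).Adj x y) : HasSubdivShadow G m v x (n + 1) := by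
  obtain ⟨-, e, i, hi, ⟨rfl, rfl⟩ | ⟨rfl, rfl⟩⟩ := hxy <;>
    rw [hasSubdivShadow_pathVertex (by omega) (by omega)] at h ⊢ <;>
    obtain ⟨l, rfl, h⟩ | ⟨l, rfl, h⟩ := h
  · exact Or.inl ⟨l + 2, by ring, h.add_two⟩
  · exact Or.inr ⟨l, by omega, h⟩
  · exact Or.inl ⟨l, by ring, h⟩
  · exact Or.inr ⟨l + 2, by omega, h.add_two⟩

lemma hasSubdivShadow_of_walk {x : SubdivVertex G m}
    (w : (subdivision G m).Walk x (.inl v)) : HasSubdivShadow G m v x w.length := by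
  generalize hy : (Sum.inl v : SubdivVertex G m) = y at w
  induction w with
  | nil =>
    subst hy
    exact ⟨.nil, 0, rfl⟩
  | cons h w ih => exact (ih hy).of_adj h

/-- The position of an inner vertex of `G^{1/m}` on its path, counted from `0`. Branch vertices get
the dummy value `0`. -/
def pathIndex : SubdivVertex G m → ℕ :=
  Sum.elim (fun _ => 0) fun x => x.2

lemma odd_pathIndex_add_of_adj {x y : SubdivVertex G m} (hxy : (subdivision G m).Adj x y)
    (hx : ∀ u, .inl u ≠ x) (hy : ∀ u, .inl u ≠ y) : Odd (pathIndex x + pathIndex y) := by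
  have odd_of_step (e : G.edgeSet) (i : ℕ) (hi : i < m) (h₀ : ∀ u, .inl u ≠ pathVertex G m e i)
      (h₁ : ∀ u, .inl u ≠ pathVertex G m e (i + 1)) :
      Odd (pathIndex (pathVertex G m e i) + pathIndex (pathVertex G m e (i + 1))) := by
    rcases i with - | i
    · exact absurd (pathVertex_zero e).symm (h₀ _)
    · rcases (Nat.succ_le_of_lt hi).lt_or_eq with him | rfl
      · rw [pathVertex_succ (by omega), pathVertex_succ (by omega)]
        exact ⟨i, by simp only [pathIndex, Sum.elim_inr]; ring⟩
      · exact absurd (pathVertex_last (by omega) e).symm (h₁ _)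
  obtain ⟨-, e, i, hi, ⟨rfl, rfl⟩ | ⟨rfl, rfl⟩⟩ := hxy
  · exact odd_of_step e i hi hx hy
  · rw [add_comm]
    exact odd_of_step e i hi hy hx

lemma even_length_add_pathIndex {x y : SubdivVertex G m} (w : (subdivision G m).Walk x y)
    (hw : ∀ u, .inl u ∉ w.support) : Even (w.length + pathIndex x + pathIndex y) := by
  induction w with
  | nil => exact ⟨_, by rw [Walk.length_nil, zero_add]⟩
  | cons h w ih =>
    simp only [Walk.support_cons, List.mem_cons, not_or] at hw
    have hrest := ih fun u => (hw u).2
    have hstep := odd_pathIndex_add_of_adj h (fun u => (hw u).1) fun u hu =>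
      (hw u).2 (hu ▸ w.start_mem_support)
    rw [Walk.length_cons]
    grind

/-- An odd closed walk meets a branch vertex, because the parity of the position alternates between
consecutive inner vertices. Starting it there makes the shadow a closed walk. -/
lemma exists_odd_closed_of_subdivision {x : SubdivVertex G m}
    (w : (subdivision G m).Walk x x) (hw : Odd w.length) :
    ∃ (u : V) (q : G.Walk u u), Odd q.length ∧ m * q.length ≤ w.length := by
  classical
  obtain ⟨u, hu⟩ : ∃ u, .inl u ∈ w.support := by
    by_contra! h
    have heven := even_length_add_pathIndex w h
    grind
  have hrotate : (w.rotate _ hu).length = w.length := by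
    simpa only [Walk.length_darts] using (w.rotate_darts _ hu).perm.length_eq
  obtain ⟨q, j, hq⟩ := hasSubdivShadow_of_walk (w.rotate _ hu)
  rw [hrotate] at hq
  refine ⟨u, q, ?_, by omega⟩
  rw [hq, Nat.odd_add] at hw
  exact (Nat.odd_mul.1 (hw.2 (even_two_mul j))).2

lemma subdivision_walk_length_ne {k : ℕ} (hk : Odd k) (hog : (k : ℕ∞) < m * oddGirth G)
    (x : SubdivVertex G m) (w : (subdivision G m).Walk x x) : w.length ≠ k := by
  rintro rfl
  obtain ⟨u, q, hq, hle⟩ := exists_odd_closed_of_subdivision w hk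
  refine hog.not_ge ?_
  calc (m : ℕ∞) * oddGirth G ≤ m * q.length := by gcongr; exact oddGirth_le_length q hq
    _ ≤ w.length := by exact_mod_cast hle

end Shadow

end Subdivision

section FracPower

variable {V : Type*} {G : SimpleGraph V} {k m : ℕ}

lemma antipodalDefect_fracPower_le (hm : Odd m) (hk : Odd k) :
    antipodalDefect (fracPower G k m) ≤ k / m * antipodalDefect G := by
  refine (antipodalDefect_power_le (subdivision G m) hk).trans_eq ?_
  rw [antipodalDefect_subdivision hm]
  ring

lemma antipodalDefect_fracPower (hm : Odd m) (hk : Odd k) (hog : (k : ℕ∞) < m * oddGirth G)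
    (hδ : antipodalDefect (fracPower G k m) < 1 / 4) :
    antipodalDefect (fracPower G k m) = k / m * antipodalDefect G := by
  refine (antipodalDefect_fracPower_le hm hk).antisymm ?_
  calc k / m * antipodalDefect G = k * antipodalDefect (subdivision G m) := by
        rw [antipodalDefect_subdivision hm]
        ring
    _ ≤ antipodalDefect (fracPower G k m) :=
        mul_antipodalDefect_le_antipodalDefect_power hk hδ (subdivision_walk_length_ne hk hog)

lemma lt_mul_oddGirth (hm : 0 < m) (hk : 0 < k) (hδ : k / m * antipodalDefect G ≤ 1 / 6) :
    (k : ℕ∞) < m * oddGirth G := by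
  have hm0 : (0 : ℝ) < m := Nat.cast_pos.2 hm
  have three_mul_le (u : V) (p : G.Walk u u) (hp : Odd p.length) : 3 * k ≤ p.length * m := by
    have hkδ : k * antipodalDefect G ≤ m / 6 := by
      rw [div_mul_eq_mul_div, div_le_iff₀ hm0] at hδ
      linarith
    have h : (3 * k : ℝ) ≤ p.length * m := by
      linarith [mul_le_mul_of_nonneg_left (half_le_length_mul_antipodalDefect p hp) k.cast_nonneg,
        mul_le_mul_of_nonneg_left hkδ p.length.cast_nonneg]
    exact_mod_cast h
  have hog : ((k / m + 1 : ℕ) : ℕ∞) ≤ oddGirth G := by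
    refine le_iInf₂ fun u p => le_iInf₂ fun _ hp => ?_
    rw [Nat.cast_le, Nat.succ_le_iff, Nat.div_lt_iff_lt_mul hm]
    linarith [three_mul_le u p hp]
  calc (k : ℕ∞) < ((m * (k / m + 1) : ℕ) : ℕ∞) := Nat.cast_lt.2 (Nat.lt_mul_div_succ k hm)
    _ = m * ((k / m + 1 : ℕ) : ℕ∞) := Nat.cast_mul _ _
    _ ≤ m * oddGirth G := by gcongr

end FracPower

section Colouring

lemma abs_div_sub_half_le_iff {n : ℝ} (hn : 0 < n) {d z : ℝ} :
    |z / n - 1 / 2| ≤ 1 / 2 - d / n ↔ d ≤ z ∧ z ≤ n - d := by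
  have h₁ : d ≤ z ↔ d / n ≤ z / n := (div_le_div_iff_of_pos_right hn).symm
  have h₂ : z ≤ n - d ↔ z / n ≤ 1 - d / n := by
    rw [← div_le_div_iff_of_pos_right hn, sub_div, div_self hn.ne']
  rw [abs_le, h₁, h₂]
  constructor <;> rintro ⟨_, _⟩ <;> constructor <;> linarith

lemma le_abs_floor_sub_floor {x y : ℝ} {z : ℤ} (h : z ≤ |x - y|) : z ≤ |⌊x⌋ - ⌊y⌋| := by
  have floor_add_le {x y : ℝ} (h : y + z ≤ x) : ⌊y⌋ + z ≤ ⌊x⌋ := by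
    rw [← Int.floor_add_intCast]
    exact Int.floor_mono h
  rcases le_abs'.1 h with h | h
  · exact le_abs'.2 (Or.inl (by linarith [floor_add_le (x := y) (y := x) (by linarith)]))
  · exact le_abs'.2 (Or.inr (by linarith [floor_add_le (x := x) (y := y) (by linarith)]))

lemma abs_floor_sub_floor_le {x y : ℝ} {z : ℤ} (h : |x - y| ≤ z) : |⌊x⌋ - ⌊y⌋| ≤ z := by
  have floor_le_add {x y : ℝ} (h : x ≤ y + z) : ⌊x⌋ ≤ ⌊y⌋ + z := by
    rw [← Int.floor_add_intCast]
    exact Int.floor_mono h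
  rw [abs_le] at h ⊢
  constructor
  · linarith [floor_le_add (x := y) (y := x) (by linarith)]
  · linarith [floor_le_add (x := x) (y := y) (by linarith)]

variable {V : Type*} {G : SimpleGraph V} {n d : ℕ}

lemma antipodalDefect_le_of_hom (hd : 0 < d) (hn : 2 * d ≤ n) (φ : G →g circularComplete n d) :
    antipodalDefect G ≤ 1 / 2 - d / n := by
  have hn0 : (0 : ℝ) < n := Nat.cast_pos.2 (by omega)
  have hdn : (d / n : ℝ) ≤ 1 / 2 := by
    rw [div_le_div_iff₀ hn0 two_pos]
    exact_mod_cast (by omega : d * 2 ≤ 1 * n)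
  refine IsAntipodalLabelling.antipodalDefect_le
    (f := fun v => (((φ v : ℕ) / n : ℝ) : UnitAddCircle)) (fun u v huv => ?_) (by linarith)
  obtain ⟨-, hle, hge⟩ := φ.map_adj huv.symm
  have hdiff : |((φ v : ℕ) / n - (φ u : ℕ) / n : ℝ)| = |((φ v : ℕ) - (φ u : ℕ) : ℝ)| / n := by
    rw [← sub_div, abs_div, Nat.abs_cast]
  have hbounds : (d : ℝ) ≤ |((φ v : ℕ) - (φ u : ℕ) : ℝ)| ∧
      |((φ v : ℕ) - (φ u : ℕ) : ℝ)| ≤ n - d := ⟨by exact_mod_cast hle, by exact_mod_cast hge⟩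
  rw [← AddCircle.coe_sub, norm_coe_sub_halfTurn, hdiff]
  · exact (abs_div_sub_half_le_iff hn0).2 hbounds
  · rw [hdiff, div_le_one hn0]
    linarith [hbounds.2, (Nat.cast_nonneg d : (0 : ℝ) ≤ d)]

lemma nonempty_hom_of_antipodalDefect_le (hd : 0 < d) (hn : 0 < n)
    (hδ : antipodalDefect G ≤ 1 / 2 - d / n) : Nonempty (G →g circularComplete n d) := by
  obtain ⟨f, hf⟩ := exists_isAntipodalLabelling_antipodalDefect G
  have hn0 : (0 : ℝ) < n := Nat.cast_pos.2 hn
  choose t ht htf using fun v => AddCircle.eq_coe_Ico (f v)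
  have hnt (v : V) : 0 ≤ n * t v := mul_nonneg hn0.le (ht v).1
  let c (v : V) : Fin n := ⟨⌊n * t v⌋₊, (Nat.floor_lt (hnt v)).2 (by nlinarith [(ht v).2])⟩
  have hc (v : V) : ((c v : ℕ) : ℤ) = ⌊n * t v⌋ := Int.natCast_floor_eq_floor (hnt v)
  refine ⟨c, fun {u v} huv => ?_⟩
  have hle_one : |t u - t v| ≤ 1 :=
    abs_le.2 ⟨by linarith [(ht u).1, (ht v).2], by linarith [(ht u).2, (ht v).1]⟩
  have hdist : d ≤ n * |t u - t v| ∧ n * |t u - t v| ≤ n - d := by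
    rw [← abs_div_sub_half_le_iff hn0, mul_div_cancel_left₀ _ hn0.ne',
      ← norm_coe_sub_halfTurn hle_one, AddCircle.coe_sub, htf, htf]
    exact (hf huv.symm).trans hδ
  rw [← Nat.abs_cast n, ← abs_mul, mul_sub, Nat.abs_cast] at hdist
  have hle : (d : ℤ) ≤ |((c u : ℕ) : ℤ) - (c v : ℕ)| := by
    rw [hc, hc]
    exact le_abs_floor_sub_floor (by exact_mod_cast hdist.1)
  have hge : |((c u : ℕ) : ℤ) - (c v : ℕ)| ≤ n - d := by
    rw [hc, hc]
    exact abs_floor_sub_floor_le (by exact_mod_cast hdist.2)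
  refine ⟨fun huv => ?_, hle, hge⟩
  rw [huv, sub_self, abs_zero] at hle
  omega

lemma nonempty_hom_circularComplete_iff (hd : 0 < d) (hn : 2 * d ≤ n) :
    Nonempty (G →g circularComplete n d) ↔ antipodalDefect G ≤ 1 / 2 - d / n :=
  ⟨fun ⟨φ⟩ => antipodalDefect_le_of_hom hd hn φ,
    nonempty_hom_of_antipodalDefect_le hd (by omega)⟩

lemma circularComplete_one (n : ℕ) : circularComplete n 1 = ⊤ := by
  ext i j
  refine ⟨fun h => h.1, fun h => ⟨h, Int.one_le_abs (sub_ne_zero.2 ?_), ?_⟩⟩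
  · exact_mod_cast Fin.val_ne_of_ne h
  · rw [abs_le]
    omega

lemma colorable_iff_antipodalDefect_le (hn : 2 ≤ n) :
    G.Colorable n ↔ antipodalDefect G ≤ 1 / 2 - 1 / n := by
  have h := nonempty_hom_circularComplete_iff (G := G) one_pos hn
  rwa [circularComplete_one, Nat.cast_one] at h

lemma antipodalDefect_lt_half [Finite V] : antipodalDefect G < 1 / 2 := by
  have := Fintype.ofFinite V
  have hcol : G.Colorable (Fintype.card V + 2) := G.colorable_of_fintype.mono (by omega)
  have hδ := (colorable_iff_antipodalDefect_le (by omega)).1 hcol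
  have hpos : (0 : ℝ) < 1 / (Fintype.card V + 2 : ℕ) := by positivity
  linarith

lemma chi_le_iff_colorable [Finite V] : chi G ≤ n ↔ G.Colorable n :=
  ⟨(colorable_chromaticNumber_of_fintype G).mono,
    fun h => ENat.toNat_le_of_le_natCast h.chromaticNumber_le⟩

lemma circularChromaticNumber_eq (hδ : antipodalDefect G < 1 / 2) :
    circularChromaticNumber G = 1 / (1 / 2 - antipodalDefect G) := by
  have hδ' : 0 < 1 / 2 - antipodalDefect G := sub_pos.2 hδ
  have exists_hom_lt (x : ℝ) (hx : 1 / (1 / 2 - antipodalDefect G) < x) :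
      ∃ n d : ℕ, 0 < d ∧ 2 * d ≤ n ∧ Nonempty (G →g circularComplete n d) ∧ (n / d : ℝ) < x := by
    obtain ⟨q, hq, hqx⟩ := exists_rat_btwn hx
    have hq0 : 0 ≤ q := by exact_mod_cast (one_div_pos.2 hδ').le.trans hq.le
    lift q to ℚ≥0 using hq0
    rw [Rat.cast_nnratCast, NNRat.cast_def] at hq hqx
    have hq0 : (0 : ℝ) < q.num / q.den := (one_div_pos.2 hδ').trans hq
    rw [one_div_lt hδ' hq0, one_div_div] at hq
    have hnum : (0 : ℝ) < q.num := by
      rwa [div_pos_iff_of_pos_right (Nat.cast_pos.2 q.den_pos)] at hq0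
    have hle : 2 * q.den ≤ q.num := by
      have hhalf : (q.den / q.num : ℝ) ≤ 1 / 2 := by linarith [antipodalDefect_nonneg (G := G)]
      rw [div_le_div_iff₀ hnum two_pos, mul_comm, one_mul] at hhalf
      exact_mod_cast hhalf
    exact ⟨q.num, q.den, q.den_pos, hle,
      (nonempty_hom_circularComplete_iff q.den_pos hle).2 (by linarith), hqx⟩
  refine csInf_eq_of_forall_ge_of_forall_gt_exists_lt ?_ ?_ ?_
  · obtain ⟨n, d, hd, hn, hφ, -⟩ := exists_hom_lt _ (lt_add_one _)
    exact ⟨_, n, d, hd, hn, hφ, rfl⟩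
  · rintro _ ⟨n, d, hd, hn, hφ, rfl⟩
    have hle := (nonempty_hom_circularComplete_iff hd hn).1 hφ
    rw [one_div_le hδ' (div_pos (Nat.cast_pos.2 (by omega)) (Nat.cast_pos.2 hd)), one_div_div]
    linarith
  · intro x hx
    obtain ⟨n, d, hd, hn, hφ, hlt⟩ := exists_hom_lt x hx
    exact ⟨_, ⟨n, d, hd, hn, hφ, rfl⟩, hlt⟩

lemma circularChromaticNumber_lt_four_iff [Finite V] :
    circularChromaticNumber G < 4 ↔ antipodalDefect G < 1 / 4 := by
  have hδ : 0 < 1 / 2 - antipodalDefect G := sub_pos.2 antipodalDefect_lt_half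
  rw [circularChromaticNumber_eq antipodalDefect_lt_half, one_div_lt hδ four_pos]
  constructor <;> intro h <;> linarith

lemma circularChromaticNumber_div_sub_two [Finite V] :
    circularChromaticNumber G / (circularChromaticNumber G - 2) = 1 / (2 * antipodalDefect G) := by
  have hδ' : 0 < 1 / 2 - antipodalDefect G := sub_pos.2 antipodalDefect_lt_half
  have hsub : 1 / (1 / 2 - antipodalDefect G) - 2 =
      2 * antipodalDefect G / (1 / 2 - antipodalDefect G) := by
    rw [div_sub' hδ'.ne']
    ring
  rw [circularChromaticNumber_eq antipodalDefect_lt_half, hsub, div_div_div_cancel_right₀ hδ'.ne']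

end Colouring

section Thickness

variable {V : Type*} {G : SimpleGraph V} [Finite V]

lemma chi_fracPower_le_three_and_lt_iff {k m : ℕ} (hm : Odd m) (hk : Odd k) :
    chi (fracPower G k m) ≤ 3 ∧ (k : ℕ∞) < m * oddGirth G ↔
      k / m * antipodalDefect G ≤ 1 / 6 := by
  have hchi : chi (fracPower G k m) ≤ 3 ↔ antipodalDefect (fracPower G k m) ≤ 1 / 6 := by
    rw [chi_le_iff_colorable, colorable_iff_antipodalDefect_le (by norm_num)]
    norm_num
  rw [hchi]
  constructor
  · rintro ⟨hδ, hog⟩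
    rwa [← antipodalDefect_fracPower hm hk hog (by linarith)]
  · intro hδ
    exact ⟨(antipodalDefect_fracPower_le hm hk).trans hδ, lt_mul_oddGirth hm.pos hk.pos hδ⟩

lemma exists_odd_div_odd_btwn {a b : ℝ} (ha : 0 ≤ a) (hab : a < b) :
    ∃ r s : ℕ, a < (2 * r + 1 : ℝ) / (2 * s + 1) ∧ (2 * r + 1 : ℝ) / (2 * s + 1) < b := by
  obtain ⟨s, hs⟩ := exists_nat_gt (2 / (b - a))
  rw [div_lt_iff₀ (by linarith)] at hs
  have hs0 : (0 : ℝ) < 2 * s + 1 := by positivity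
  refine ⟨⌊((2 * s + 1) * a + 1) / 2⌋₊, s, ?_, ?_⟩
  · rw [lt_div_iff₀ hs0]
    linarith [Nat.lt_floor_add_one (((2 * s + 1) * a + 1) / 2)]
  · rw [div_lt_iff₀ hs0]
    linarith [Nat.floor_le (show 0 ≤ ((2 * s + 1) * a + 1) / 2 by positivity)]

lemma chi_fracPower_le_three_and_lt_iff_le_one_div (hδ : 0 < antipodalDefect G) (r s : ℕ) :
    chi (fracPower G (2 * r + 1) (2 * s + 1)) ≤ 3 ∧
        ((2 * r + 1 : ℕ) : ℕ∞) < ((2 * s + 1 : ℕ) : ℕ∞) * oddGirth G ↔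
      (2 * r + 1 : ℝ) / (2 * s + 1) ≤ 1 / (6 * antipodalDefect G) := by
  rw [chi_fracPower_le_three_and_lt_iff ⟨s, rfl⟩ ⟨r, rfl⟩,
    le_div_iff₀ (show 0 < 6 * antipodalDefect G by positivity)]
  push_cast
  constructor <;> intro h <;> linarith

lemma mu_eq (hδ : 0 < antipodalDefect G) : mu G = 1 / (6 * antipodalDefect G) := by
  have hpos : 0 < 1 / (6 * antipodalDefect G) := by positivity
  have exists_admissible {w : ℝ} (hw : w < 1 / (6 * antipodalDefect G)) :
      ∃ r s : ℕ, (chi (fracPower G (2 * r + 1) (2 * s + 1)) ≤ 3 ∧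
        ((2 * r + 1 : ℕ) : ℕ∞) < ((2 * s + 1 : ℕ) : ℕ∞) * oddGirth G) ∧
        w < (2 * r + 1 : ℝ) / (2 * s + 1) := by
    obtain ⟨r, s, hlt, hle⟩ := exists_odd_div_odd_btwn (le_max_right w 0) (max_lt hw hpos)
    exact ⟨r, s, (chi_fracPower_le_three_and_lt_iff_le_one_div hδ r s).2 hle.le,
      (le_max_left w 0).trans_lt hlt⟩
  have chi_le_iff (n : ℕ) : (n : ℤ) ≤ (chi G : ℤ) + (3 - (chi G : ℤ)) ↔ n ≤ 3 := by omega
  simp only [mu, powerThickness, chi_le_iff]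
  refine csSup_eq_of_forall_le_of_forall_lt_exists_gt ?_ ?_ ?_
  · obtain ⟨r, s, ⟨hchi, hog⟩, -⟩ := exists_admissible hpos
    exact ⟨_, r, s, hchi, hog, rfl⟩
  · rintro _ ⟨r, s, hchi, hog, rfl⟩
    exact (chi_fracPower_le_three_and_lt_iff_le_one_div hδ r s).1 ⟨hchi, hog⟩
  · intro w hw
    obtain ⟨r, s, ⟨hchi, hog⟩, hlt⟩ := exists_admissible hw
    exact ⟨_, ⟨r, s, hchi, hog, rfl⟩, hlt⟩

end Thickness

end GraphPower

theorem mainTheorem10 {V : Type*} [Finite V] (G : SimpleGraph V) (hG : ¬ G.IsBipartite)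
    (r s : ℕ)
    (hog : ((2 * r + 1 : ℕ) : ℕ∞) < ((2 * s + 1 : ℕ) : ℕ∞) * GraphPower.oddGirth G)
    (hχ : GraphPower.circularChromaticNumber
      (GraphPower.fracPower G (2 * r + 1) (2 * s + 1)) < 4) :
    GraphPower.mu (GraphPower.fracPower G (2 * r + 1) (2 * s + 1)) =
        (2 * s + 1 : ℝ) / (2 * r + 1 : ℝ) * GraphPower.mu G ∧
      (2 * s + 1 : ℝ) / (2 * r + 1 : ℝ) * GraphPower.mu G =
        (2 * s + 1 : ℝ) / (3 * (2 * r + 1 : ℝ)) *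
          (GraphPower.circularChromaticNumber G /
            (GraphPower.circularChromaticNumber G - 2)) := by
  open GraphPower in
  have hδ : 0 < antipodalDefect G := antipodalDefect_pos hG
  have hpower_lt : antipodalDefect (fracPower G (2 * r + 1) (2 * s + 1)) < 1 / 4 :=
    circularChromaticNumber_lt_four_iff.1 hχ
  have hpower : antipodalDefect (fracPower G (2 * r + 1) (2 * s + 1)) =
      (2 * r + 1) / (2 * s + 1) * antipodalDefect G := by
    exact_mod_cast antipodalDefect_fracPower ⟨s, rfl⟩ ⟨r, rfl⟩ hog hpower_lt
  constructor
  · rw [mu_eq (by rw [hpower]; positivity), mu_eq hδ, hpower]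
    field_simp
  · rw [mu_eq hδ, circularChromaticNumber_div_sub_two]
    field_simp
    norm_num
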